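/- Let $q$ be a complex number with $0<|q|<1$ and write $(u;q)_\infty=\prod_{j\ge 0}(1-uq^j)$ and $(u_1,\dots,u_m;q)_\infty=\prod_{l=1}^m(u_l;q)_\infty$. For $a_1,\dots,a_r,b_1,\dots,b_r\in\mathbb C$ the multiple Jackson $q$-integral is $$\int_{a_1}^{b_1}\!\!\cdots\int_{a_r}^{b_r} g(t_1,\dots,t_r)\,d_qt_r\cdots d_qt_1 =\sum_{S\subseteq\{1,\dots,r\}}\Big(\prod_{i\in S}(-a_i)\Big)\Big(\prod_{i\notin S}b_i\Big)(1-q)^r \sum_{k_1,\dots,k_r=0}^\infty g\big(c_1(S)q^{k_1},\dots,c_r(S)q^{k_r}\big)\,q^{k_1+\cdots+k_r},$$ where $c_i(S)=a_i$ if $i\in S$ and $c_i(S)=b_i$ if $i\notin S$; it is said to converge absolutely if each of the $2^r$ inner series does. **Theorem.** Let $r\ge 0$ be an integer, let $a,b,d,e,f,x_1,\dots,x_r$ be nonzero complex numbers, and let $c=abdefq^{r-1}$. Assume that none of the numbers $adx_iq^k$, $aex_iq^k$, $afq^k$, $bdq^k$, $beq^k$, $bfq^k/x_i$ ($1\le i\le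 r$, $k\ge 0$ an integer) equals $1$, i.e. that no denominator below vanishes. Then the following $q$-integral converges absolutely, and $$\int_{ax_1}^{b}\!\!\cdots\int_{ax_r}^{b}\ \prod_{1\le i<j\le r}(t_i-t_j) \prod_{i=1}^r\frac{(qt_i/ax_i,\,qt_i/b,\,ct_i;q)_\infty}{(dt_i,\,et_i,\,ft_i/x_i;q)_\infty}\,d_qt_r\cdots d_qt_1$$ $$=a^{\binom r2}b^r(1-q)^r\prod_{1\le i<j\le r}(x_i-x_j) \prod_{i=1}^r\frac{(q,\,ax_i/b,\,bq/ax_i,\,cq^{1-i}/d,\,cq^{1-i}/e,\,cx_i/f;q)_\infty} {(adx_i,\,aex_i,\,af,\,bdq^{i-1},\,beq^{i-1},\,bf/x_i;q)_\infty}.$$ (Here $u/ax_i$ means $u/(ax_i)$.) -/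

import Mathlib

/-- The infinite `q`-shifted factorial `(a; q)_∞ = ∏_{j ≥ 0} (1 - a q ^ j)`. -/
noncomputable def qPochInf (a q : ℂ) : ℂ := ∏' j : ℕ, (1 - a * q ^ j)

/-- For `|q| < 1` the product defining `(a; q)_∞` converges, so `qPochInf` is its true value. -/
theorem multipliable_qPochInf (a : ℂ) {q : ℂ} (hq : ‖q‖ < 1) :
    Multipliable fun j : ℕ => 1 - a * q ^ j := by
  have h : Summable fun j : ℕ => ‖-(a * q ^ j)‖ := by
    simp only [norm_neg, norm_mul, norm_pow]
    exact (summable_geometric_of_lt_one (norm_nonneg q) hq).mul_left ‖a‖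
  simpa only [sub_eq_add_neg] using multipliable_one_add_of_summable h

/-- The end point `c_i(S)`: it is the lower limit `lo i` if `i ∈ S` and the upper limit `hi i`
otherwise. -/
def qCorner {r : ℕ} (lo hi : Fin r → ℂ) (S : Finset (Fin r)) (i : Fin r) : ℂ :=
  if i ∈ S then lo i else hi i

/-- The term with index `k = (k_1, …, k_r)` of the multiple series attached to `S`:
`f(c_1(S) q ^ k_1, …, c_r(S) q ^ k_r) q ^ (k_1 + ⋯ + k_r)`. -/
noncomputable def qIntegralTerm {r : ℕ} (q : ℂ) (lo hi : Fin r → ℂ) (f : (Fin r → ℂ) → ℂ)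
    (S : Finset (Fin r)) (k : Fin r → ℕ) : ℂ :=
  f (fun i => qCorner lo hi S i * q ^ k i) * q ^ (∑ i, k i)

/-- The multiple Jackson `q`-integral exists: each of its `2 ^ r` multiple series converges
absolutely. -/
def QIntegrable {r : ℕ} (q : ℂ) (lo hi : Fin r → ℂ) (f : (Fin r → ℂ) → ℂ) : Prop :=
  ∀ S : Finset (Fin r), Summable (qIntegralTerm q lo hi f S)

/-- The multiple Jackson `q`-integral
`∫_{lo 1}^{hi 1} ⋯ ∫_{lo r}^{hi r} f(t_1, …, t_r) d_q t_r ⋯ d_q t_1`. -/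
noncomputable def qIntegral {r : ℕ} (q : ℂ) (lo hi : Fin r → ℂ) (f : (Fin r → ℂ) → ℂ) : ℂ :=
  ∑ S : Finset (Fin r),
    (∏ i ∈ S, -lo i) * (∏ i ∈ Sᶜ, hi i) * (1 - q) ^ r *
      ∑' k : Fin r → ℕ, qIntegralTerm q lo hi f S k

/-- The product `∏_{1 ≤ i < j ≤ r} (t_i - t_j)`. -/
def vandermondeProd {r : ℕ} (t : Fin r → ℂ) : ℂ :=
  ∏ i : Fin r, ∏ j ∈ Finset.Ioi i, (t i - t j)

/-! ### The infinite `q`-shifted factorial: zeros, continuity, finite shifts. -/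

open Filter Topology

/-! The Vandermonde product is a determinant, so up to a sign the integrand is `det (t_i ^ j *
w_i(t_i))` with one weight `w_i` per variable. Row `i` involves only `t_i`, hence the integral is
the determinant of the moments of the `w_i` (`qIntegral_det`).

To evaluate that determinant, replace the monomials by the polynomials `(dX;q)_j (eX;q)_{r-1-j}`,
which multiplies the moment matrix on the right by their coefficient matrix. Against `w_i` such a
polynomial only shifts `d, e` to `d q^j, e q^(r-1-j)`. The factor `q^(r-1)` in `c` is exactly what
keeps every shifted weight balanced, so each entry is a nonterminating `q`-Saalschütz integral
(`qBetaIntegral_eq`). Its value is a row factor times a column factor times the same polynomial at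
`a x_i` (`qBetaMoment_mul_qPochCoeff`). The matrix is therefore a diagonal matrix times the
Vandermonde matrix of the `a x_i`, times the coefficient matrix, times a diagonal matrix. The
coefficient determinant cancels when `d` avoids finitely many values, and continuity in `d` covers
the rest (`det_qBetaMoment`).

In one dimension, a telescoping relation between `f` and `f q` lets `f`, then `d`, then `e` be sent
to `0`. The remaining constant is read off at `e = q / a`, where the weight collapses to
`(qt/b;q)_∞` and its sum telescopes. -/

lemma qPochInf_zero (q : ℂ) : qPochInf 0 q = 1 := by simp [qPochInf]

lemma qPochInf_eq_mul (z : ℂ) {q : ℂ} (hq : ‖q‖ < 1) :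
    qPochInf z q = (1 - z) * qPochInf (z * q) q := by
  have e : (fun j : ℕ => 1 - z * q * q ^ j) = fun j : ℕ => 1 - z * q ^ (j + 1) := by
    funext j
    ring
  have h := multipliable_qPochInf (z * q) hq
  rw [e] at h
  have h' := tprod_eq_zero_mul' (f := fun j : ℕ => 1 - z * q ^ j) h
  rw [← e] at h'
  rw [qPochInf, h', qPochInf, pow_zero, mul_one]

lemma qPochInf_ne_zero {z q : ℂ} (hq : ‖q‖ < 1) (h : ∀ k : ℕ, z * q ^ k ≠ 1) :
    qPochInf z q ≠ 0 := by
  unfold qPochInf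
  simp only [sub_eq_add_neg]
  refine tprod_one_add_ne_zero_of_summable (f := fun k => -(z * q ^ k)) (fun k => ?_) ?_
  · rw [← sub_eq_add_neg]
    exact sub_ne_zero.2 (h k).symm
  · simp only [norm_neg, norm_mul, norm_pow]
    exact (summable_geometric_of_lt_one (norm_nonneg q) hq).mul_left ‖z‖

lemma continuous_qPochInf {q : ℂ} (hq : ‖q‖ < 1) : Continuous fun z => qPochInf z q := by
  rw [continuous_iff_continuousAt]
  intro z
  have hK : IsOpen (Metric.ball (0 : ℂ) (‖z‖ + 1)) := Metric.isOpen_ball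
  have h := Summable.hasProdLocallyUniformlyOn_nat_one_add (f := fun (j : ℕ) (z : ℂ) => -(z * q ^ j)) hK
    (u := fun j => (‖z‖ + 1) * ‖q‖ ^ j)
    ((summable_geometric_of_lt_one (norm_nonneg q) hq).mul_left _)
    (Eventually.of_forall fun j w hw => by
      rw [norm_neg, norm_mul, norm_pow]
      have : ‖w‖ < ‖z‖ + 1 := by simpa using hw
      gcongr)
    (fun j => by fun_prop)
  simp only [← sub_eq_add_neg] at h
  have hc := h.tendstoLocallyUniformlyOn_finsetRange.continuousOn
    (Frequently.of_forall fun n => by fun_prop)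
  exact hc.continuousAt (hK.mem_nhds (by simp))

lemma continuousAt_qPochInf_comp {X : Type*} [TopologicalSpace X] {f : X → ℂ} {x : X} {q : ℂ}
    (hq : ‖q‖ < 1) (hf : ContinuousAt f x) : ContinuousAt (fun y => qPochInf (f y) q) x :=
  ContinuousAt.comp (g := fun z => qPochInf z q) (continuous_qPochInf hq).continuousAt hf

/-- The finite `q`-shifted factorial `(z; q)_n`. -/
noncomputable def qPoch (z q : ℂ) (n : ℕ) : ℂ := ∏ m ∈ Finset.range n, (1 - z * q ^ m)

lemma qPochInf_eq_qPoch_mul (z : ℂ) {q : ℂ} (hq : ‖q‖ < 1) (n : ℕ) :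
    qPochInf z q = qPoch z q n * qPochInf (z * q ^ n) q := by
  induction n with
  | zero => simp [qPoch]
  | succ n ih =>
    rw [ih, qPochInf_eq_mul (z * q ^ n) hq, qPoch, qPoch, Finset.prod_range_succ, pow_succ,
      mul_assoc, ← mul_assoc z, mul_assoc (∏ _m ∈ _, _)]

lemma tendsto_mul_pow_zero {q : ℂ} (hq : ‖q‖ < 1) (z : ℂ) :
    Tendsto (fun n : ℕ => z * q ^ n) atTop (𝓝 0) := by
  simpa using (tendsto_pow_atTop_nhds_zero_of_norm_lt_one hq).const_mul z

/-! ### Convergence and parameter continuity of series over the nodes `q ^ k`. -/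

section Jackson

variable {P : Type*} [TopologicalSpace P] {q : ℂ} {F : P → ℂ → ℂ} {p₀ : P}

/-- The nodes accumulate only at `0`: joint continuity at `(p₀, 0)` bounds all but finitely many of
them uniformly in `p`, and continuity at each remaining node handles the others. The bound serves as
a geometric majorant for dominated convergence. -/
lemma eventually_norm_le_of_continuousAt_pow (hq : ‖q‖ < 1)
    (h0 : ContinuousAt (Function.uncurry F) (p₀, 0))
    (hk : ∀ k : ℕ, ContinuousAt (fun p => F p (q ^ k)) p₀) :
    ∃ C, ∀ᶠ p in 𝓝 p₀, ∀ k : ℕ, ‖F p (q ^ k)‖ ≤ C := by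
  have hpow : Tendsto (fun k : ℕ => q ^ k) atTop (𝓝 0) :=
    tendsto_pow_atTop_nhds_zero_of_norm_lt_one hq
  have hlt : ∀ᶠ x in 𝓝 p₀ ×ˢ 𝓝 (0 : ℂ), ‖F x.1 x.2‖ < ‖F p₀ 0‖ + 1 := by
    rw [← nhds_prod_eq]
    exact h0.norm.eventually (gt_mem_nhds (by simp [Function.uncurry]))
  obtain ⟨pa, hpa, pb, hpb, hab⟩ := eventually_prod_iff.1 hlt
  obtain ⟨N, hN⟩ := eventually_atTop.1 (hpow.eventually hpb)
  have hfin : ∀ᶠ p in 𝓝 p₀, ∀ k ∈ Finset.range N, ‖F p (q ^ k)‖ < ‖F p₀ (q ^ k)‖ + 1 := by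
    rw [Finset.eventually_all]
    exact fun k _ => (hk k).norm.eventually (gt_mem_nhds (by simp))
  refine ⟨‖F p₀ 0‖ + 1 + ∑ k ∈ Finset.range N, (‖F p₀ (q ^ k)‖ + 1), ?_⟩
  filter_upwards [hpa, hfin] with p hp hp' k
  have hnn : ∀ k ∈ Finset.range N, 0 ≤ ‖F p₀ (q ^ k)‖ + 1 := fun k _ => by positivity
  by_cases h : k < N
  · have h1 := hp' k (Finset.mem_range.2 h)
    have h2 := Finset.single_le_sum hnn (Finset.mem_range.2 h)
    have h3 := norm_nonneg (F p₀ 0)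
    linarith
  · have h1 := hab hp (hN k (not_lt.1 h))
    have h2 := Finset.sum_nonneg hnn
    simp only at h1
    linarith

lemma continuousAt_tsum_pow (hq : ‖q‖ < 1)
    (h0 : ContinuousAt (Function.uncurry F) (p₀, 0))
    (hk : ∀ k : ℕ, ContinuousAt (fun p => F p (q ^ k)) p₀) :
    ContinuousAt (fun p => ∑' k : ℕ, F p (q ^ k) * q ^ k) p₀ := by
  obtain ⟨C, hC⟩ := eventually_norm_le_of_continuousAt_pow hq h0 hk
  refine tendsto_tsum_of_dominated_convergence (bound := fun k => C * ‖q‖ ^ k)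
    ((summable_geometric_of_lt_one (norm_nonneg q) hq).mul_left C)
    (fun k => ((hk k).mul continuousAt_const)) ?_
  filter_upwards [hC] with p hp k
  rw [norm_mul, norm_pow]
  exact mul_le_mul_of_nonneg_right (hp k) (by positivity)

lemma summable_pow_of_continuousAt_zero {G : ℂ → ℂ} (hq : ‖q‖ < 1) (h0 : ContinuousAt G 0) :
    Summable fun k : ℕ => G (q ^ k) * q ^ k := by
  obtain ⟨C, hC⟩ := eventually_norm_le_of_continuousAt_pow (P := Unit) (F := fun _ => G)
    (p₀ := ()) hq (h0.comp (f := Prod.snd) (x := ((), (0 : ℂ))) continuousAt_snd)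
    (fun _ => continuousAt_const)
  refine Summable.of_norm_bounded (g := fun k => C * ‖q‖ ^ k)
    ((summable_geometric_of_lt_one (norm_nonneg q) hq).mul_left C) fun k => ?_
  rw [norm_mul, norm_pow]
  exact mul_le_mul_of_nonneg_right (hC.self_of_nhds k) (by positivity)

end Jackson

/-! ### One-dimensional Jackson integrals and the `q`-beta weight. -/

/-- The series `∑ g(u q ^ k) q ^ k` of the Jackson integral from `0` to `u`. -/
noncomputable def jacksonSum (q : ℂ) (g : ℂ → ℂ) (u : ℂ) : ℂ := ∑' k : ℕ, g (u * q ^ k) * q ^ k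

/-- The one-dimensional Jackson integral of `g` from `a` to `b`. -/
noncomputable def jacksonIntegral (q a b : ℂ) (g : ℂ → ℂ) : ℂ :=
  (1 - q) * (b * jacksonSum q g b - a * jacksonSum q g a)

/-- A discrete fundamental theorem of calculus: partial sums are `Φ u - Φ (u q ^ n)`, and continuity
of `Φ` at `0` gives the limit. -/
lemma mul_jacksonSum_eq_of_telescope {q : ℂ} (hq : ‖q‖ < 1) {g Φ : ℂ → ℂ} {u : ℂ} (hg : ContinuousAt g 0)
    (hΦ : ContinuousAt Φ 0)
    (h : ∀ k : ℕ, u * g (u * q ^ k) * q ^ k = Φ (u * q ^ k) - Φ (u * q ^ (k + 1))) :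
    u * jacksonSum q g u = Φ u - Φ 0 := by
  have hs : Summable fun k : ℕ => g (u * q ^ k) * q ^ k :=
    summable_pow_of_continuousAt_zero (G := fun s => g (u * s)) hq
      (ContinuousAt.comp (g := g) (by simpa using hg) (by fun_prop))
  have h1 := (hs.mul_left u).hasSum.tendsto_sum_nat
  rw [tsum_mul_left] at h1
  have h2 : Tendsto (fun n : ℕ => Φ u - Φ (u * q ^ n)) atTop (𝓝 (Φ u - Φ 0)) :=
    (hΦ.tendsto.comp (tendsto_mul_pow_zero hq u)).const_sub _
  refine tendsto_nhds_unique h1 (h2.congr fun n => ?_)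
  have := Finset.sum_range_sub' (fun k : ℕ => Φ (u * q ^ k)) n
  simp only [pow_zero, mul_one] at this
  rw [← this]
  exact Finset.sum_congr rfl fun k _ => by rw [← h k, mul_assoc]

/-- The integrand `(q t / a, q t / b, c t; q)_∞ / (d t, e t, f t; q)_∞`. -/
noncomputable def qBetaIntegrand (q a b c d e f t : ℂ) : ℂ :=
  qPochInf (q * t / a) q * qPochInf (q * t / b) q * qPochInf (c * t) q /
    (qPochInf (d * t) q * qPochInf (e * t) q * qPochInf (f * t) q)

lemma continuousAt_qBetaIntegrand_comp {X : Type*} [TopologicalSpace X] {q a b : ℂ} (hq : ‖q‖ < 1)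
    {c d e f t : X → ℂ} {x : X} (hc : ContinuousAt c x) (hd : ContinuousAt d x)
    (he : ContinuousAt e x) (hf : ContinuousAt f x) (ht : ContinuousAt t x)
    (hdt : qPochInf (d x * t x) q ≠ 0) (het : qPochInf (e x * t x) q ≠ 0)
    (hft : qPochInf (f x * t x) q ≠ 0) :
    ContinuousAt (fun y => qBetaIntegrand q a b (c y) (d y) (e y) (f y) (t y)) x := by
  have hq' {g : X → ℂ} (hg : ContinuousAt g x) : ContinuousAt (fun y => qPochInf (g y) q) x :=
    continuousAt_qPochInf_comp hq hg
  unfold qBetaIntegrand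
  refine ContinuousAt.div ?_ ?_ (by simp [hdt, het, hft])
  · exact ((hq' (by fun_prop)).mul (hq' (by fun_prop))).mul (hq' (by fun_prop))
  · exact ((hq' (by fun_prop)).mul (hq' (by fun_prop))).mul (hq' (by fun_prop))

lemma continuousAt_zero_qBetaIntegrand {q : ℂ} (hq : ‖q‖ < 1) (a b c d e f : ℂ) :
    ContinuousAt (qBetaIntegrand q a b c d e f) 0 :=
  continuousAt_qBetaIntegrand_comp hq continuousAt_const continuousAt_const continuousAt_const
    continuousAt_const continuousAt_id (by simp [qPochInf_zero]) (by simp [qPochInf_zero])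
    (by simp [qPochInf_zero])

lemma summable_jackson {q : ℂ} (hq : ‖q‖ < 1) {g : ℂ → ℂ} (hg : ContinuousAt g 0) (u : ℂ) :
    Summable fun k : ℕ => g (u * q ^ k) * q ^ k :=
  summable_pow_of_continuousAt_zero (G := fun s => g (u * s)) hq
    (ContinuousAt.comp (g := g) (by simpa using hg) (by fun_prop))

lemma jacksonSum_sub_mul {q : ℂ} (hq : ‖q‖ < 1) {g h : ℂ → ℂ} (hg : ContinuousAt g 0)
    (hh : ContinuousAt h 0) (α β u : ℂ) :
    jacksonSum q (fun t => α * g t - β * h t) u = α * jacksonSum q g u - β * jacksonSum q h u := by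
  unfold jacksonSum
  rw [← tsum_mul_left, ← tsum_mul_left,
    ← ((summable_jackson hq hg u).mul_left α).tsum_sub ((summable_jackson hq hh u).mul_left β)]
  exact tsum_congr fun k => by ring

lemma jacksonIntegral_congr {q a b : ℂ} {g h : ℂ → ℂ} (ha : ∀ k : ℕ, g (a * q ^ k) = h (a * q ^ k))
    (hb : ∀ k : ℕ, g (b * q ^ k) = h (b * q ^ k)) :
    jacksonIntegral q a b g = jacksonIntegral q a b h := by
  simp only [jacksonIntegral, jacksonSum, ha, hb]

lemma qPochInf_node_ne_zero {z q u : ℂ} (hq : ‖q‖ < 1) (h : ∀ k : ℕ, u * z * q ^ k ≠ 1) (n : ℕ) :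
    qPochInf (z * (u * q ^ n)) q ≠ 0 := by
  refine qPochInf_ne_zero hq fun k => ?_
  rw [show z * (u * q ^ n) * q ^ k = u * z * q ^ (n + k) by ring]
  exact h _

lemma ne_zero_of_qPochInf_ne_zero {z q : ℂ} (hq : ‖q‖ < 1) (h : qPochInf z q ≠ 0) :
    1 - z ≠ 0 ∧ qPochInf (z * q) q ≠ 0 := by
  rw [qPochInf_eq_mul z hq] at h
  exact ⟨left_ne_zero_of_mul h, right_ne_zero_of_mul h⟩

lemma qPochInf_one {q : ℂ} (hq : ‖q‖ < 1) : qPochInf 1 q = 0 := by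
  rw [qPochInf_eq_mul 1 hq]; simp

/-! ### The contiguous relation between `f` and `f q`. -/

section

variable {q a b d e f : ℂ}

/-- Makes the combination of the two weights a `q`-difference. After the common infinite products
are divided out, only the polynomial identity `key` is left. -/
lemma qBetaIntegrand_contiguous (hq : ‖q‖ < 1) (ha : a ≠ 0) (hb : b ≠ 0) {t : ℂ}
    (hd : qPochInf (d * t) q ≠ 0) (he : qPochInf (e * t) q ≠ 0) (hf : qPochInf (f * t) q ≠ 0) :
    t * ((1 - a * f) * (1 - b * f) * qBetaIntegrand q a b (a * b * d * e * f) d e f t -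
      (1 - a * b * d * f) * (1 - a * b * e * f) *
        qBetaIntegrand q a b (a * b * d * e * (f * q)) d e (f * q) t) =
    a * b * f * (qPochInf (t / a) q * qPochInf (t / b) q * qPochInf (a * b * d * e * f * t) q /
        (qPochInf (d * t) q * qPochInf (e * t) q * qPochInf (f * t) q) -
      qPochInf (t * q / a) q * qPochInf (t * q / b) q * qPochInf (a * b * d * e * f * (t * q)) q /
        (qPochInf (d * (t * q)) q * qPochInf (e * (t * q)) q * qPochInf (f * (t * q)) q)) := by
  obtain ⟨hd1, hd2⟩ := ne_zero_of_qPochInf_ne_zero hq hd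
  obtain ⟨he1, he2⟩ := ne_zero_of_qPochInf_ne_zero hq he
  obtain ⟨hf1, hf2⟩ := ne_zero_of_qPochInf_ne_zero hq hf
  unfold qBetaIntegrand
  rw [qPochInf_eq_mul (d * t) hq, qPochInf_eq_mul (e * t) hq, qPochInf_eq_mul (f * t) hq,
    qPochInf_eq_mul (a * b * d * e * f * t) hq, qPochInf_eq_mul (t / a) hq,
    qPochInf_eq_mul (t / b) hq,
    show q * t / a = t / a * q by ring, show q * t / b = t / b * q by ring,
    show t * q / a = t / a * q by ring, show t * q / b = t / b * q by ring,
    show a * b * d * e * (f * q) * t = a * b * d * e * f * t * q by ring,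
    show f * q * t = f * t * q by ring, show d * (t * q) = d * t * q by ring,
    show e * (t * q) = e * t * q by ring, show f * (t * q) = f * t * q by ring,
    show a * b * d * e * f * (t * q) = a * b * d * e * f * t * q by ring]
  generalize qPochInf (d * t * q) q = D at *
  generalize qPochInf (e * t * q) q = E at *
  generalize qPochInf (f * t * q) q = F at *
  generalize qPochInf (t / a * q) q = A at *
  generalize qPochInf (t / b * q) q = B at *
  generalize qPochInf (a * b * d * e * f * t * q) q = C at *
  -- On the right the constant terms cancel, and so do the cubic ones because `c = abdef`; what
  -- remains is `t` times a linear polynomial.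
  have key : t * ((1 - a * f) * (1 - b * f) * (1 - a * b * d * e * f * t) -
      (1 - a * b * d * f) * (1 - a * b * e * f) * (1 - f * t)) =
      a * b * f * ((1 - t / a) * (1 - t / b) * (1 - a * b * d * e * f * t) -
        (1 - d * t) * (1 - e * t) * (1 - f * t)) := by
    field_simp
    ring
  generalize 1 - d * t = X at *
  generalize 1 - e * t = Y at *
  generalize 1 - f * t = Z at *
  generalize 1 - a * b * d * e * f * t = U at *
  generalize 1 - t / a = V at *
  generalize 1 - t / b = W at *
  rw [show A * B * (U * C) / (X * D * (Y * E) * (Z * F)) =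
      U * (A * B * C / (X * D * (Y * E) * (Z * F))) by ring,
    show A * B * C / (X * D * (Y * E) * F) = Z * (A * B * C / (X * D * (Y * E) * (Z * F))) by
      field_simp,
    show V * A * (W * B) * (U * C) / (X * D * (Y * E) * (Z * F)) =
      V * W * U * (A * B * C / (X * D * (Y * E) * (Z * F))) by ring,
    show A * B * C / (D * E * F) = X * Y * Z * (A * B * C / (X * D * (Y * E) * (Z * F))) by
      field_simp]
  linear_combination (A * B * C / (X * D * (Y * E) * (Z * F))) * key

/-- The primitive `Φ` contains `(t/a, t/b;q)_∞`, so it vanishes at both end points. Each end point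
then contributes the same value `-Φ 0`, and the two cancel. -/
lemma qBetaIntegral_contiguous (hq : ‖q‖ < 1) (ha : a ≠ 0) (hb : b ≠ 0)
    (had : ∀ k : ℕ, a * d * q ^ k ≠ 1) (hae : ∀ k : ℕ, a * e * q ^ k ≠ 1)
    (haf : ∀ k : ℕ, a * f * q ^ k ≠ 1) (hbd : ∀ k : ℕ, b * d * q ^ k ≠ 1)
    (hbe : ∀ k : ℕ, b * e * q ^ k ≠ 1) (hbf : ∀ k : ℕ, b * f * q ^ k ≠ 1) :
    (1 - a * f) * (1 - b * f) *
        jacksonIntegral q a b (qBetaIntegrand q a b (a * b * d * e * f) d e f) =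
      (1 - a * b * d * f) * (1 - a * b * e * f) *
        jacksonIntegral q a b (qBetaIntegrand q a b (a * b * d * e * (f * q)) d e (f * q)) := by
  set g := qBetaIntegrand q a b (a * b * d * e * f) d e f with hg
  set h := qBetaIntegrand q a b (a * b * d * e * (f * q)) d e (f * q) with hh
  have hgc : ContinuousAt g 0 := continuousAt_zero_qBetaIntegrand hq ..
  have hhc : ContinuousAt h 0 := continuousAt_zero_qBetaIntegrand hq ..
  let Φ : ℂ → ℂ := fun t => a * b * f * (qPochInf (t / a) q * qPochInf (t / b) q *
    qPochInf (a * b * d * e * f * t) q /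
      (qPochInf (d * t) q * qPochInf (e * t) q * qPochInf (f * t) q))
  have hq' {G : ℂ → ℂ} (hG : ContinuousAt G 0) : ContinuousAt (fun y => qPochInf (G y) q) 0 :=
    continuousAt_qPochInf_comp hq hG
  have hΦc : ContinuousAt Φ 0 := by
    refine continuousAt_const.mul (ContinuousAt.div ?_ ?_ (by simp [qPochInf_zero]))
    · exact ((hq' (by fun_prop)).mul (hq' (by fun_prop))).mul (hq' (by fun_prop))
    · exact ((hq' (by fun_prop)).mul (hq' (by fun_prop))).mul (hq' (by fun_prop))
  have main (u : ℂ) (hd : ∀ k : ℕ, u * d * q ^ k ≠ 1) (he : ∀ k : ℕ, u * e * q ^ k ≠ 1)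
      (hf : ∀ k : ℕ, u * f * q ^ k ≠ 1) (hu : Φ u = 0) :
      u * ((1 - a * f) * (1 - b * f) * jacksonSum q g u -
        (1 - a * b * d * f) * (1 - a * b * e * f) * jacksonSum q h u) = - Φ 0 := by
    rw [← jacksonSum_sub_mul hq hgc hhc, mul_jacksonSum_eq_of_telescope hq (Φ := Φ) (by fun_prop) hΦc, hu,
      zero_sub]
    intro k
    have := qBetaIntegrand_contiguous hq ha hb (qPochInf_node_ne_zero hq hd k)
      (qPochInf_node_ne_zero hq he k) (qPochInf_node_ne_zero hq hf k)
    simp only [Φ, pow_succ, ← mul_assoc u]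
    rw [hg, hh, ← mul_sub (a * b * f), ← this]
    ring
  have h1 := main a had hae haf (by simp [Φ, div_self ha, qPochInf_one hq])
  have h2 := main b hbd hbe hbf (by simp [Φ, div_self hb, qPochInf_one hq])
  unfold jacksonIntegral
  linear_combination (1 - q) * (h2 - h1)

end

/-! ### Evaluation of the one-dimensional integral. -/

section

variable {q a b d e f : ℂ}

lemma continuousAt_jacksonIntegral_qBetaIntegrand {P : Type*} [TopologicalSpace P]
    {c d e f : P → ℂ} {p : P} (hq : ‖q‖ < 1) (j : ℕ)
    (hc : ContinuousAt c p) (hd : ContinuousAt d p) (he : ContinuousAt e p) (hf : ContinuousAt f p)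
    (had : ∀ k : ℕ, a * d p * q ^ k ≠ 1) (hae : ∀ k : ℕ, a * e p * q ^ k ≠ 1)
    (haf : ∀ k : ℕ, a * f p * q ^ k ≠ 1) (hbd : ∀ k : ℕ, b * d p * q ^ k ≠ 1)
    (hbe : ∀ k : ℕ, b * e p * q ^ k ≠ 1) (hbf : ∀ k : ℕ, b * f p * q ^ k ≠ 1) :
    ContinuousAt (fun x => jacksonIntegral q a b
      (fun t => t ^ j * qBetaIntegrand q a b (c x) (d x) (e x) (f x) t)) p := by
  have main (u : ℂ) (hud : ∀ k : ℕ, u * d p * q ^ k ≠ 1) (hue : ∀ k : ℕ, u * e p * q ^ k ≠ 1)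
      (huf : ∀ k : ℕ, u * f p * q ^ k ≠ 1) : ContinuousAt (fun x => jacksonSum q
        (fun t => t ^ j * qBetaIntegrand q a b (c x) (d x) (e x) (f x) t) u) p := by
    refine continuousAt_tsum_pow (F := fun x s =>
      (u * s) ^ j * qBetaIntegrand q a b (c x) (d x) (e x) (f x) (u * s)) hq ?_ fun k => ?_
    · refine ContinuousAt.mul (by fun_prop) (continuousAt_qBetaIntegrand_comp hq ?_ ?_ ?_ ?_ ?_
        (by simp [qPochInf_zero]) (by simp [qPochInf_zero]) (by simp [qPochInf_zero]))
      · exact hc.comp (f := Prod.fst) continuousAt_fst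
      · exact hd.comp (f := Prod.fst) continuousAt_fst
      · exact he.comp (f := Prod.fst) continuousAt_fst
      · exact hf.comp (f := Prod.fst) continuousAt_fst
      · fun_prop
    · exact ContinuousAt.mul (by fun_prop) (continuousAt_qBetaIntegrand_comp hq hc hd he hf
        continuousAt_const (qPochInf_node_ne_zero hq hud k) (qPochInf_node_ne_zero hq hue k)
        (qPochInf_node_ne_zero hq huf k))
  exact continuousAt_const.mul ((continuousAt_const.mul (main b hbd hbe hbf)).sub
    (continuousAt_const.mul (main a had hae haf)))

/-- Iterate the contiguous relation along `f q ^ n` and let `n → ∞`, using continuity of the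
integral at `f = 0`. -/
lemma qBetaIntegral_reduce (hq : ‖q‖ < 1) (ha : a ≠ 0) (hb : b ≠ 0)
    (had : ∀ k : ℕ, a * d * q ^ k ≠ 1) (hae : ∀ k : ℕ, a * e * q ^ k ≠ 1)
    (haf : ∀ k : ℕ, a * f * q ^ k ≠ 1) (hbd : ∀ k : ℕ, b * d * q ^ k ≠ 1)
    (hbe : ∀ k : ℕ, b * e * q ^ k ≠ 1) (hbf : ∀ k : ℕ, b * f * q ^ k ≠ 1) :
    qPochInf (a * f) q * qPochInf (b * f) q *
        jacksonIntegral q a b (qBetaIntegrand q a b (a * b * d * e * f) d e f) =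
      qPochInf (a * b * d * f) q * qPochInf (a * b * e * f) q *
        jacksonIntegral q a b (qBetaIntegrand q a b 0 d e 0) := by
  let J : ℂ → ℂ := fun f => jacksonIntegral q a b (qBetaIntegrand q a b (a * b * d * e * f) d e f)
  let A : ℂ → ℂ := fun f => qPochInf (a * f) q * qPochInf (b * f) q * J f
  let B : ℂ → ℂ := fun f => qPochInf (a * b * d * f) q * qPochInf (a * b * e * f) q
  have hq' {G : ℂ → ℂ} (hG : ContinuousAt G 0) : ContinuousAt (fun y => qPochInf (G y) q) 0 :=
    continuousAt_qPochInf_comp hq hG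
  have hJ : ContinuousAt J 0 := by
    have := continuousAt_jacksonIntegral_qBetaIntegrand (a := a) (b := b) (p := (0 : ℂ))
      (c := fun f => a * b * d * e * f) (d := fun _ => d) (e := fun _ => e) (f := fun f => f)
      hq 0 (by fun_prop) (by fun_prop) (by fun_prop) (by fun_prop) had hae (by simp) hbd hbe
      (by simp)
    simpa only [pow_zero, one_mul] using this
  have hA : ContinuousAt A 0 := ((hq' (by fun_prop)).mul (hq' (by fun_prop))).mul hJ
  have hB : ContinuousAt B 0 := (hq' (by fun_prop)).mul (hq' (by fun_prop))
  -- `M` is the product of the factors `(1 - abdg)(1 - abeg)` over `g = f q ^ m`, `m < n`; both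
  -- sides acquire the same one.
  have hiter (n : ℕ) : ∃ M, A f = M * A (f * q ^ n) ∧ B f = M * B (f * q ^ n) := by
    induction n with
    | zero => exact ⟨1, by simp⟩
    | succ n ih =>
      obtain ⟨M, h1, h2⟩ := ih
      set g := f * q ^ n with hg
      have hg' : f * q ^ (n + 1) = g * q := by rw [hg, pow_succ, mul_assoc]
      have hag (k : ℕ) : a * g * q ^ k ≠ 1 := by
        rw [show a * g * q ^ k = a * f * q ^ (n + k) by rw [hg]; ring]
        exact haf _
      have hbg (k : ℕ) : b * g * q ^ k ≠ 1 := by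
        rw [show b * g * q ^ k = b * f * q ^ (n + k) by rw [hg]; ring]
        exact hbf _
      have hrec := qBetaIntegral_contiguous hq ha hb had hae hag hbd hbe hbg
      refine ⟨M * ((1 - a * b * d * g) * (1 - a * b * e * g)), ?_, ?_⟩
      · rw [h1, hg']
        simp only [A, J]
        rw [qPochInf_eq_mul (a * g) hq, qPochInf_eq_mul (b * g) hq, mul_assoc a g q,
          mul_assoc b g q]
        linear_combination M * qPochInf (a * (g * q)) q * qPochInf (b * (g * q)) q * hrec
      · rw [h2, hg']
        simp only [B]
        rw [qPochInf_eq_mul (a * b * d * g) hq, qPochInf_eq_mul (a * b * e * g) hq]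
        simp only [mul_assoc]
        ring
  -- Cross-multiplying eliminates `M` without dividing by it, since it may vanish.
  have hAB (n : ℕ) : A f * B (f * q ^ n) = B f * A (f * q ^ n) := by
    obtain ⟨M, h1, h2⟩ := hiter n
    rw [h1, h2]
    ring
  have hlim := tendsto_mul_pow_zero hq f
  have h := tendsto_nhds_unique (((hB.tendsto.comp hlim).const_mul (A f)).congr hAB)
    ((hA.tendsto.comp hlim).const_mul (B f))
  simpa [A, B, J, qPochInf_zero] using h

lemma qBetaIntegrand_swap (c t : ℂ) :
    qBetaIntegrand q a b c d e f t = qBetaIntegrand q a b c f e d t := by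
  unfold qBetaIntegrand
  ring

lemma qBetaIntegrand_swap' (c t : ℂ) :
    qBetaIntegrand q a b c d e f t = qBetaIntegrand q a b c d f e t := by
  unfold qBetaIntegrand
  ring

lemma qBetaIntegral_reduce_zero (hq : ‖q‖ < 1) (ha : a ≠ 0) (hb : b ≠ 0)
    (hae : ∀ k : ℕ, a * e * q ^ k ≠ 1) (hbe : ∀ k : ℕ, b * e * q ^ k ≠ 1) :
    qPochInf (a * e) q * qPochInf (b * e) q *
        jacksonIntegral q a b (qBetaIntegrand q a b 0 0 e 0) =
      jacksonIntegral q a b (qBetaIntegrand q a b 0 0 0 0) := by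
  have h := qBetaIntegral_reduce (d := 0) (e := 0) (f := e) hq ha hb (by simp) (by simp) hae
    (by simp) (by simp) hbe
  simp only [mul_zero, zero_mul, qPochInf_zero, one_mul] at h
  rw [← h]
  congr 2
  funext t
  exact qBetaIntegrand_swap' 0 t

/-- Removing `f` makes `c = 0`. The weight is symmetric in `d, e, f`, so the same reduction then
removes `d`, producing `(abde;q)_∞`, and finally `e`, producing no new factor on the right. -/
lemma qBetaIntegral_reduce_all (hq : ‖q‖ < 1) (ha : a ≠ 0) (hb : b ≠ 0)
    (had : ∀ k : ℕ, a * d * q ^ k ≠ 1) (hae : ∀ k : ℕ, a * e * q ^ k ≠ 1)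
    (haf : ∀ k : ℕ, a * f * q ^ k ≠ 1) (hbd : ∀ k : ℕ, b * d * q ^ k ≠ 1)
    (hbe : ∀ k : ℕ, b * e * q ^ k ≠ 1) (hbf : ∀ k : ℕ, b * f * q ^ k ≠ 1) :
    qPochInf (a * d) q * qPochInf (a * e) q * qPochInf (a * f) q * qPochInf (b * d) q *
        qPochInf (b * e) q * qPochInf (b * f) q *
        jacksonIntegral q a b (qBetaIntegrand q a b (a * b * d * e * f) d e f) =
      qPochInf (a * b * d * e) q * qPochInf (a * b * d * f) q * qPochInf (a * b * e * f) q *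
        jacksonIntegral q a b (qBetaIntegrand q a b 0 0 0 0) := by
  have h1 := qBetaIntegral_reduce hq ha hb had hae haf hbd hbe hbf
  have h2 := qBetaIntegral_reduce (d := 0) (f := d) hq ha hb (by simp) hae had (by simp) hbe hbd
  have h3 := qBetaIntegral_reduce_zero hq ha hb hae hbe
  have h4 : jacksonIntegral q a b (qBetaIntegrand q a b 0 d e 0) =
      jacksonIntegral q a b (qBetaIntegrand q a b 0 0 e d) :=
    congrArg _ (funext fun t => qBetaIntegrand_swap 0 t)
  simp only [mul_zero, zero_mul, qPochInf_zero, one_mul, ← h4] at h2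
  rw [show a * b * e * d = a * b * d * e by ring] at h2
  linear_combination qPochInf (a * d) q * qPochInf (a * e) q * qPochInf (b * d) q *
        qPochInf (b * e) q * h1 + qPochInf (a * b * d * f) q * qPochInf (a * b * e * f) q *
        qPochInf (a * e) q * qPochInf (b * e) q * h2 + qPochInf (a * b * d * e) q *
        qPochInf (a * b * d * f) q * qPochInf (a * b * e * f) q * h3

/-- Telescopes with primitive `-b (t/b;q)_∞`. -/
lemma jacksonSum_qPochInf (hq : ‖q‖ < 1) (hb : b ≠ 0) (u : ℂ) :
    u * jacksonSum q (fun t => qPochInf (q * t / b) q) u = b * (1 - qPochInf (u / b) q) := by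
  have hc (s : ℂ) : ContinuousAt (fun t => -b * qPochInf (s * t / b) q) 0 :=
    continuousAt_const.mul (continuousAt_qPochInf_comp hq (by fun_prop))
  have hc' : ContinuousAt (fun t => qPochInf (q * t / b) q) 0 :=
    continuousAt_qPochInf_comp hq (by fun_prop)
  have h := mul_jacksonSum_eq_of_telescope (u := u) hq hc' (hc 1) fun k => by
    rw [show 1 * (u * q ^ k) / b = u * q ^ k / b by ring, qPochInf_eq_mul (u * q ^ k / b) hq,
      show q * (u * q ^ k) / b = u * q ^ k / b * q by ring,
      show 1 * (u * q ^ (k + 1)) / b = u * q ^ k / b * q by ring]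
    field_simp
    ring
  rw [h]
  simp [qPochInf_zero]
  ring

/-- The choice `e = q / a` cancels `(qt/a;q)_∞`. The hypothesis `h` keeps this factor nonzero at the
nodes `b q ^ k`; at the nodes `a q ^ k` that is automatic. -/
lemma qBetaIntegral_zero_of_ne (hq : ‖q‖ < 1) (ha : a ≠ 0) (hb : b ≠ 0)
    (h : ∀ k : ℕ, b * (q / a) * q ^ k ≠ 1) :
    jacksonIntegral q a b (qBetaIntegrand q a b 0 0 0 0) =
      b * (1 - q) * qPochInf q q * qPochInf (a / b) q * qPochInf (b * q / a) q := by
  have hqq : ∀ k : ℕ, a * (q / a) * q ^ k ≠ 1 := fun k => by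
    rw [mul_div_cancel₀ _ ha, ← pow_succ']
    intro h1
    have h2 : ‖q ^ (k + 1)‖ < 1 := by
      rw [norm_pow]
      exact pow_lt_one₀ (norm_nonneg q) hq k.succ_ne_zero
    simp [h1] at h2
  have key := qBetaIntegral_reduce_zero (e := q / a) hq ha hb hqq h
  have hne (u : ℂ) (hu : ∀ k : ℕ, u * (q / a) * q ^ k ≠ 1) (k : ℕ) :
      qBetaIntegrand q a b 0 0 (q / a) 0 (u * q ^ k) = qPochInf (q * (u * q ^ k) / b) q := by
    have h1 := qPochInf_node_ne_zero hq hu k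
    unfold qBetaIntegrand
    rw [show q * (u * q ^ k) / a = q / a * (u * q ^ k) by ring]
    simp only [zero_mul, qPochInf_zero, one_mul, mul_one]
    rw [mul_div_cancel_left₀ _ h1]
  rw [jacksonIntegral_congr (h := fun t => qPochInf (q * t / b) q) (hne a hqq) (hne b h), jacksonIntegral, jacksonSum_qPochInf hq hb,
    jacksonSum_qPochInf hq hb, div_self hb, qPochInf_one hq, mul_div_cancel₀ _ ha,
    show b * (q / a) = b * q / a by ring] at key
  rw [← key]
  ring

lemma jacksonIntegral_swap (g : ℂ → ℂ) : jacksonIntegral q a b g = -jacksonIntegral q b a g := by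
  unfold jacksonIntegral
  ring

lemma qBetaIntegral_zero (hq : ‖q‖ < 1) (ha : a ≠ 0) (hb : b ≠ 0) :
    jacksonIntegral q a b (qBetaIntegrand q a b 0 0 0 0) =
      b * (1 - q) * qPochInf q q * qPochInf (a / b) q * qPochInf (b * q / a) q := by
  by_cases h : ∀ k : ℕ, b * (q / a) * q ^ k ≠ 1
  · exact qBetaIntegral_zero_of_ne hq ha hb h
  -- Here `a = b q ^ (k + 1)`. The exchanged pair cannot be exceptional too, as `q ^ (k + j + 2) ≠
  -- 1`, and both sides are antisymmetric in `a, b`.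
  · push Not at h
    obtain ⟨k, hk⟩ := h
    have h' : ∀ j : ℕ, a * (q / b) * q ^ j ≠ 1 := fun j hj => by
      have h1 : q ^ (k + j + 2) = 1 := by
        calc q ^ (k + j + 2) = (b * (q / a) * q ^ k) * (a * (q / b) * q ^ j) := by
              field_simp
              ring
          _ = 1 := by rw [hk, hj, one_mul]
      have h2 : ‖q ^ (k + j + 2)‖ < 1 := by
        rw [norm_pow]
        exact pow_lt_one₀ (norm_nonneg q) hq (by omega)
      simp [h1] at h2
    have h3 := qBetaIntegral_zero_of_ne hq hb ha h'
    have h4 : qBetaIntegrand q b a 0 0 0 0 = qBetaIntegrand q a b 0 0 0 0 := by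
      funext t
      unfold qBetaIntegrand
      ring
    rw [jacksonIntegral_swap, ← h4, h3, qPochInf_eq_mul (b / a) hq, qPochInf_eq_mul (a / b) hq,
      show a * q / b = a / b * q by ring, show b * q / a = b / a * q by ring]
    field_simp
    ring

/-- The nonterminating `q`-Saalschütz sum as a `q`-integral (Al-Salam and Verma). -/
theorem qBetaIntegral_eq (hq : ‖q‖ < 1) (ha : a ≠ 0) (hb : b ≠ 0)
    (had : ∀ k : ℕ, a * d * q ^ k ≠ 1) (hae : ∀ k : ℕ, a * e * q ^ k ≠ 1)
    (haf : ∀ k : ℕ, a * f * q ^ k ≠ 1) (hbd : ∀ k : ℕ, b * d * q ^ k ≠ 1)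
    (hbe : ∀ k : ℕ, b * e * q ^ k ≠ 1) (hbf : ∀ k : ℕ, b * f * q ^ k ≠ 1) :
    jacksonIntegral q a b (qBetaIntegrand q a b (a * b * d * e * f) d e f) =
      b * (1 - q) * (qPochInf q q * qPochInf (a / b) q * qPochInf (b * q / a) q *
        qPochInf (a * b * e * f) q * qPochInf (a * b * d * f) q * qPochInf (a * b * d * e) q) /
      (qPochInf (a * d) q * qPochInf (a * e) q * qPochInf (a * f) q *
        qPochInf (b * d) q * qPochInf (b * e) q * qPochInf (b * f) q) := by
  have h := qBetaIntegral_reduce_all hq ha hb had hae haf hbd hbe hbf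
  rw [qBetaIntegral_zero hq ha hb] at h
  have h1 := qPochInf_ne_zero hq had
  have h2 := qPochInf_ne_zero hq hae
  have h3 := qPochInf_ne_zero hq haf
  have h4 := qPochInf_ne_zero hq hbd
  have h5 := qPochInf_ne_zero hq hbe
  have h6 := qPochInf_ne_zero hq hbf
  rw [eq_div_iff (by simp [*]), mul_comm, h]
  ring

end

/-! ### Multiple integrals of products and of determinants. -/

lemma hasSum_prod_pi {r : ℕ} {f : Fin r → ℕ → ℂ} (hf : ∀ i, Summable (f i)) :
    HasSum (fun k : Fin r → ℕ => ∏ i, f i (k i)) (∏ i, ∑' n, f i n) := by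
  induction r with
  | zero => simp [hasSum_unique]
  | succ r ih =>
    have h1 := ih fun i => hf i.succ
    have h2 : Summable fun x : ℕ × (Fin r → ℕ) => f 0 x.1 * ∏ i, f i.succ (x.2 i) := by
      have hn0 : Summable fun n => ‖f 0 n‖ := (hf 0).norm
      have hn1 : Summable fun k : Fin r → ℕ => ‖∏ i, f i.succ (k i)‖ := h1.summable.norm
      apply summable_mul_of_summable_norm hn0 hn1
    have h3 := (hf 0).hasSum.mul h1 h2
    rw [Fin.prod_univ_succ, ← (Fin.consEquiv fun _ : Fin (r + 1) => ℕ).hasSum_iff]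
    convert! h3 using 2 with x
    simp [Fin.prod_univ_succ, Fin.consEquiv]

section

variable {r : ℕ} {q : ℂ} {lo hi : Fin r → ℂ}

/-- Expanding a product of differences between upper and lower contributions over subsets reproduces
the sum over `S`, the set of variables placed at the lower limit. -/
lemma qIntegral_prod {g : Fin r → ℂ → ℂ} (hq : ‖q‖ < 1) (hg : ∀ i, ContinuousAt (g i) 0) :
    QIntegrable q lo hi (fun t => ∏ i, g i (t i)) ∧
      qIntegral q lo hi (fun t => ∏ i, g i (t i)) =
        ∏ i, jacksonIntegral q (lo i) (hi i) (g i) := by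
  have key (S : Finset (Fin r)) : HasSum (qIntegralTerm q lo hi (fun t => ∏ i, g i (t i)) S)
      (∏ i, jacksonSum q (g i) (qCorner lo hi S i)) := by
    have h := hasSum_prod_pi fun i => summable_jackson hq (hg i) (qCorner lo hi S i)
    simp only [Finset.prod_mul_distrib, Finset.prod_pow_eq_pow_sum] at h
    exact h
  refine ⟨fun S => (key S).summable, ?_⟩
  have hsplit (i : Fin r) : jacksonIntegral q (lo i) (hi i) (g i) =
      (-lo i * ((1 - q) * jacksonSum q (g i) (lo i))) +
        (hi i * ((1 - q) * jacksonSum q (g i) (hi i))) := by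
    unfold jacksonIntegral
    ring
  simp only [hsplit]
  rw [Finset.prod_add, Finset.powerset_univ]
  refine Finset.sum_congr rfl fun S _ => ?_
  rw [(key S).tsum_eq, ← Finset.compl_eq_univ_sdiff, Finset.prod_mul_distrib,
    Finset.prod_mul_distrib, ← Finset.prod_mul_prod_compl S (fun i => jacksonSum q (g i) _),
    Finset.prod_mul_distrib, Finset.prod_mul_distrib]
  have hin : ∏ i ∈ S, jacksonSum q (g i) (qCorner lo hi S i) =
      ∏ i ∈ S, jacksonSum q (g i) (lo i) :=
    Finset.prod_congr rfl fun i hi' => by simp [qCorner, hi']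
  have hout : ∏ i ∈ Sᶜ, jacksonSum q (g i) (qCorner lo hi S i) =
      ∏ i ∈ Sᶜ, jacksonSum q (g i) (hi i) :=
    Finset.prod_congr rfl fun i hi' => by simp [qCorner, Finset.mem_compl.1 hi']
  rw [hin, hout]
  have hc : (1 - q) ^ r = (∏ _i ∈ S, (1 - q)) * ∏ _i ∈ Sᶜ, (1 - q) := by
    rw [Finset.prod_mul_prod_compl, Finset.prod_const, Finset.card_univ, Fintype.card_fin]
  rw [hc]
  ring

lemma qIntegral_sum {ι : Type*} (s : Finset ι) (α : ι → ℂ) {F : ι → (Fin r → ℂ) → ℂ}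
    (hF : ∀ n ∈ s, QIntegrable q lo hi (F n)) :
    QIntegrable q lo hi (fun t => ∑ n ∈ s, α n * F n t) ∧
      qIntegral q lo hi (fun t => ∑ n ∈ s, α n * F n t) =
        ∑ n ∈ s, α n * qIntegral q lo hi (F n) := by
  have hterm (S : Finset (Fin r)) :
      qIntegralTerm q lo hi (fun t => ∑ n ∈ s, α n * F n t) S =
        fun k => ∑ n ∈ s, α n * qIntegralTerm q lo hi (F n) S k := by
    funext k
    simp only [qIntegralTerm, Finset.sum_mul, mul_assoc]
  have hs (S : Finset (Fin r)) : ∀ n ∈ s, Summable fun k =>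
      α n * qIntegralTerm q lo hi (F n) S k := fun n hn => (hF n hn S).mul_left _
  refine ⟨fun S => by rw [hterm]; exact summable_sum (hs S), ?_⟩
  unfold qIntegral
  simp only [hterm, Finset.mul_sum]
  rw [Finset.sum_comm]
  refine Finset.sum_congr rfl fun S _ => ?_
  rw [Summable.tsum_finsetSum (hs S), Finset.mul_sum]
  refine Finset.sum_congr rfl fun n _ => ?_
  rw [tsum_mul_left]
  ring

/-- Every term of the Leibniz expansion is a product of functions of separate variables. -/
lemma qIntegral_det {g : Fin r → Fin r → ℂ → ℂ} (hq : ‖q‖ < 1)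
    (hg : ∀ i j, ContinuousAt (g i j) 0) :
    QIntegrable q lo hi (fun t => (Matrix.of fun i j => g i j (t i)).det) ∧
      qIntegral q lo hi (fun t => (Matrix.of fun i j => g i j (t i)).det) =
        (Matrix.of fun i j => jacksonIntegral q (lo i) (hi i) (g i j)).det := by
  have h (σ : Equiv.Perm (Fin r)) := qIntegral_prod (lo := lo) (hi := hi)
    (g := fun i => g i (σ i)) hq fun i => hg i (σ i)
  have h' := qIntegral_sum (Finset.univ (α := Equiv.Perm (Fin r)))
    (fun σ => ((Equiv.Perm.sign σ : ℤ) : ℂ)) fun σ _ => (h σ).1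
  simp only [(h _).2] at h'
  -- The transpose makes the expansion run over entries `(i, σ i)`, so that factor `i` depends on `t
  -- i`.
  simp only [← Matrix.det_transpose (Matrix.of _), Matrix.det_apply', Matrix.transpose_apply,
    Matrix.of_apply]
  exact h'

end

/-! ### Vandermonde determinants and the polynomial basis `(dX;q)_j (eX;q)_{r-1-j}`. -/

lemma exists_vandermondeProd_eq (r : ℕ) : ∃ ε : ℂ, ∀ t : Fin r → ℂ,
    vandermondeProd t = ε * (Matrix.vandermonde t).det := by
  refine ⟨∏ i : Fin r, ∏ _j ∈ Finset.Ioi i, (-1), fun t => ?_⟩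
  rw [Matrix.det_vandermonde, ← Finset.prod_mul_distrib]
  refine Finset.prod_congr rfl fun i _ => ?_
  rw [← Finset.prod_mul_distrib]
  exact Finset.prod_congr rfl fun j _ => by ring

lemma det_vandermonde_mul {r : ℕ} (a : ℂ) (x : Fin r → ℂ) :
    (Matrix.vandermonde fun i => a * x i).det =
      a ^ r.choose 2 * (Matrix.vandermonde x).det := by
  have h : (Matrix.vandermonde fun i => a * x i) =
      Matrix.of fun i j : Fin r => a ^ (j : ℕ) * Matrix.vandermonde x i j := by
    ext i j
    simp [Matrix.vandermonde_apply, mul_pow]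
  rw [h, Matrix.det_mul_row, Finset.prod_pow_eq_pow_sum, Fin.sum_univ_eq_sum_range (fun i => i),
    Finset.sum_range_id, Nat.choose_two_right]

open Polynomial in
/-- The polynomial `(d X; q)_m (e X; q)_n`. -/
noncomputable def qPochPoly (q d e : ℂ) (m n : ℕ) : ℂ[X] :=
  (∏ k ∈ Finset.range m, (1 - C (d * q ^ k) * X)) * ∏ k ∈ Finset.range n, (1 - C (e * q ^ k) * X)

lemma eval_qPochPoly (q d e t : ℂ) (m n : ℕ) :
    (qPochPoly q d e m n).eval t = qPoch (d * t) q m * qPoch (e * t) q n := by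
  simp only [qPochPoly, qPoch, Polynomial.eval_mul, Polynomial.eval_prod, Polynomial.eval_sub,
    Polynomial.eval_one, Polynomial.eval_C, Polynomial.eval_X, mul_right_comm]

lemma natDegree_qPochPoly_le (q d e : ℂ) (m n : ℕ) :
    (qPochPoly q d e m n).natDegree ≤ m + n := by
  have h (z : ℂ) (l : ℕ) : (∏ k ∈ Finset.range l,
      (1 - Polynomial.C (z * q ^ k) * Polynomial.X)).natDegree ≤ l := by
    refine (Polynomial.natDegree_prod_le _ _).trans
      ((Finset.sum_le_card_nsmul _ _ 1 fun k _ => ?_).trans (by simp))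
    compute_degree
  exact Polynomial.natDegree_mul_le.trans (add_le_add (h d m) (h e n))

section

variable {r : ℕ} {q a b d e f : ℂ}

/-- The coefficients of the polynomials `(d X; q)_j (e X; q)_{r - 1 - j}`. -/
noncomputable def qPochCoeff (r : ℕ) (q d e : ℂ) : Matrix (Fin r) (Fin r) ℂ :=
  Matrix.of fun l j => (qPochPoly q d e j (r - 1 - j)).coeff l

lemma sum_qPochCoeff (j : Fin r) (t : ℂ) :
    ∑ l : Fin r, t ^ (l : ℕ) * qPochCoeff r q d e l j =
      qPoch (d * t) q j * qPoch (e * t) q (r - 1 - j) := by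
  have hj := j.isLt
  rw [← eval_qPochPoly, Polynomial.eval_eq_sum_range' (n := r)
    ((natDegree_qPochPoly_le ..).trans_lt (by omega)),
    ← Fin.sum_univ_eq_sum_range fun l => (qPochPoly q d e j (r - 1 - j)).coeff l * t ^ l]
  exact Finset.sum_congr rfl fun l _ => mul_comm _ _

lemma vandermonde_mul_qPochCoeff (t : Fin r → ℂ) :
    Matrix.vandermonde t * qPochCoeff r q d e =
      Matrix.of fun i j : Fin r => qPoch (d * t i) q j * qPoch (e * t i) q (r - 1 - j) := by
  ext i j
  rw [Matrix.mul_apply]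
  exact sum_qPochCoeff j (t i)

lemma pow_ne_pow_of_norm_lt_one (hq0 : q ≠ 0) (hq : ‖q‖ < 1) {m n : ℕ} (h : m < n) :
    q ^ n ≠ q ^ m := by
  intro h'
  have h1 : ‖q‖ ^ n < ‖q‖ ^ m := pow_lt_pow_right_of_lt_one₀ (norm_pos_iff.2 hq0) hq h
  rw [← norm_pow, ← norm_pow, h'] at h1
  exact lt_irrefl _ h1

/-- At the points `s i = 1 / (d q ^ i)` the factor `(d s_i;q)_j` vanishes for `j > i`, so the matrix
of values is lower triangular; `hde` keeps the factor in `e` on its diagonal nonzero. That matrix is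
Vandermonde times coefficients, so neither determinant is zero. -/
lemma det_qPochCoeff_ne_zero (hq0 : q ≠ 0) (hq : ‖q‖ < 1) (hd : d ≠ 0)
    (hde : ∀ m < r, ∀ n < r, d ≠ e * q ^ m / q ^ n) : (qPochCoeff r q d e).det ≠ 0 := by
  set s : Fin r → ℂ := fun i => 1 / (d * q ^ (i : ℕ)) with hs
  have h := congrArg Matrix.det (vandermonde_mul_qPochCoeff (q := q) (d := d) (e := e) s)
  rw [Matrix.det_mul] at h
  refine right_ne_zero_of_mul (a := (Matrix.vandermonde s).det) ?_
  rw [h, Matrix.det_of_isLowerTriangular]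
  · refine Finset.prod_ne_zero_iff.2 fun i _ => ?_
    have hi := i.isLt
    refine mul_ne_zero (Finset.prod_ne_zero_iff.2 fun m hm => ?_)
      (Finset.prod_ne_zero_iff.2 fun m hm => ?_)
    · rw [Finset.mem_range] at hm
      have h1 := pow_ne_pow_of_norm_lt_one hq0 hq hm
      have hqi := pow_ne_zero (i : ℕ) hq0
      rw [show d * s i * q ^ m = q ^ m / q ^ (i : ℕ) by simp only [hs]; field_simp]
      rw [sub_ne_zero, ne_comm, Ne, div_eq_one_iff_eq hqi]
      exact h1.symm
    · rw [Finset.mem_range] at hm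
      have h1 := hde m (by omega) i hi
      have hqi := pow_ne_zero (i : ℕ) hq0
      rw [show e * s i * q ^ m = e * q ^ m / q ^ (i : ℕ) / d by simp only [hs]; field_simp]
      rw [sub_ne_zero, ne_comm, Ne, div_eq_one_iff_eq hd]
      exact h1.symm
  · intro i j hij
    have hij' : i < j := hij
    have h0 : qPoch (d * s i) q j = 0 := by
      refine Finset.prod_eq_zero (Finset.mem_range.2 (Fin.lt_def.1 hij')) ?_
      have hqi := pow_ne_zero (i : ℕ) hq0
      simp only [hs]
      field_simp
      ring
    simp [h0]

lemma jacksonIntegral_sum {ι : Type*} (s : Finset ι) (α : ι → ℂ) {g : ι → ℂ → ℂ} (hq : ‖q‖ < 1)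
    (hg : ∀ n ∈ s, ContinuousAt (g n) 0) :
    jacksonIntegral q a b (fun t => ∑ n ∈ s, g n t * α n) =
      ∑ n ∈ s, jacksonIntegral q a b (g n) * α n := by
  have h (u : ℂ) : jacksonSum q (fun t => ∑ n ∈ s, g n t * α n) u =
      ∑ n ∈ s, jacksonSum q (g n) u * α n := by
    simp only [jacksonSum, Finset.sum_mul, ← tsum_mul_right]
    rw [← Summable.tsum_finsetSum fun n hn => (summable_jackson hq (hg n hn) u).mul_right (α n)]
    exact tsum_congr fun k => Finset.sum_congr rfl fun n _ => by ring
  simp only [jacksonIntegral, h, Finset.mul_sum, ← Finset.sum_sub_distrib]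
  exact Finset.sum_congr rfl fun n _ => by ring

/-- The moments of the one-dimensional weights. -/
noncomputable def qBetaMoment (q a b c d e f : ℂ) (x : Fin r → ℂ) : Matrix (Fin r) (Fin r) ℂ :=
  Matrix.of fun i l => jacksonIntegral q (a * x i) b
    fun t => t ^ (l : ℕ) * qBetaIntegrand q (a * x i) b c d e (f / x i) t

lemma qPoch_mul_qBetaIntegrand (hq : ‖q‖ < 1) {c t : ℂ} (m n : ℕ) (hd : qPochInf (d * t) q ≠ 0)
    (he : qPochInf (e * t) q ≠ 0) :
    qPoch (d * t) q m * qPoch (e * t) q n * qBetaIntegrand q a b c d e f t =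
      qBetaIntegrand q a b c (d * q ^ m) (e * q ^ n) f t := by
  unfold qBetaIntegrand
  rw [qPochInf_eq_qPoch_mul (d * t) hq m, qPochInf_eq_qPoch_mul (e * t) hq n] at *
  rw [show d * q ^ m * t = d * t * q ^ m by ring, show e * q ^ n * t = e * t * q ^ n by ring]
  have h1 := left_ne_zero_of_mul hd
  have h2 := left_ne_zero_of_mul he
  generalize qPoch (d * t) q m = A at *
  generalize qPoch (e * t) q n = B at *
  generalize qPochInf (d * t * q ^ m) q = A' at *
  generalize qPochInf (e * t * q ^ n) q = B' at *
  rw [show A * A' * (B * B') * qPochInf (f * t) q = (A * B) * (A' * B' * qPochInf (f * t) q) by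
    ring, ← mul_div_assoc, mul_div_mul_left _ _ (mul_ne_zero h1 h2)]

lemma mul_pow_ne_one {z u : ℂ} (h : ∀ k : ℕ, u * z * q ^ k ≠ 1) (n k : ℕ) :
    u * (z * q ^ n) * q ^ k ≠ 1 := by
  rw [show u * (z * q ^ n) * q ^ k = u * z * q ^ (n + k) by ring]
  exact h _

/-- The product in the evaluation of the multiple integral, without the Vandermonde factor. -/
noncomputable def qBetaProd (q a b d e f : ℂ) (x : Fin r → ℂ) : ℂ :=
  ∏ i : Fin r, b * (1 - q) * (qPochInf q q * qPochInf (a * x i / b) q *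
    qPochInf (b * q / (a * x i)) q * qPochInf (a * b * e * f * q ^ (r - 1 - i)) q *
    qPochInf (a * b * d * f * q ^ (r - 1 - i)) q * qPochInf (a * b * d * e * q ^ (r - 1) * x i) q) /
    (qPochInf (a * d * x i) q * qPochInf (a * e * x i) q * qPochInf (a * f) q *
      qPochInf (b * d * q ^ (i : ℕ)) q * qPochInf (b * e * q ^ (i : ℕ)) q * qPochInf (b * f / x i) q)

/-- The dependence on both `i` and `j` enters only through `(a d x_i q^j;q)_∞` and `(a e x_i
q^(r-1-j);q)_∞` in the denominator. Splitting off the full products leaves finite ones, which are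
the basis polynomials at `a x_i`. -/
lemma qBetaMoment_mul_qPochCoeff (hq : ‖q‖ < 1) (ha : a ≠ 0) (hb : b ≠ 0) {x : Fin r → ℂ}
    (hx : ∀ i, x i ≠ 0)
    (hadx : ∀ (i : Fin r) (k : ℕ), a * x i * d * q ^ k ≠ 1)
    (haex : ∀ (i : Fin r) (k : ℕ), a * x i * e * q ^ k ≠ 1)
    (haf : ∀ k : ℕ, a * f * q ^ k ≠ 1)
    (hbd : ∀ k : ℕ, b * d * q ^ k ≠ 1)
    (hbe : ∀ k : ℕ, b * e * q ^ k ≠ 1)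
    (hbf : ∀ (i : Fin r) (k : ℕ), b * (f / x i) * q ^ k ≠ 1) (i j : Fin r) :
    (qBetaMoment q a b (a * b * d * e * f * q ^ (r - 1)) d e f x * qPochCoeff r q d e) i j =
      (b * (1 - q) * (qPochInf q q * qPochInf (a * x i / b) q * qPochInf (b * q / (a * x i)) q *
        qPochInf (a * b * d * e * q ^ (r - 1) * x i) q) /
        (qPochInf (a * d * x i) q * qPochInf (a * e * x i) q * qPochInf (a * f) q *
          qPochInf (b * f / x i) q)) *
      (((qPochInf (a * b * e * f * q ^ (r - 1 - j)) q / qPochInf (b * d * q ^ (j : ℕ)) q) *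
        (qPochInf (a * b * d * f * q ^ (j : ℕ)) q / qPochInf (b * e * q ^ (r - 1 - j)) q)) *
      (qPoch (d * (a * x i)) q j * qPoch (e * (a * x i)) q (r - 1 - j))) := by
  have hxi := hx i
  have hax : a * x i ≠ 0 := mul_ne_zero ha hxi
  have haf' : ∀ k : ℕ, a * x i * (f / x i) * q ^ k ≠ 1 := fun k => by
    rw [show a * x i * (f / x i) = a * f by field_simp]
    exact haf k
  have hint : (qBetaMoment q a b (a * b * d * e * f * q ^ (r - 1)) d e f x *
      qPochCoeff r q d e) i j = jacksonIntegral q (a * x i) b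
        (qBetaIntegrand q (a * x i) b (a * b * d * e * f * q ^ (r - 1)) (d * q ^ (j : ℕ))
          (e * q ^ (r - 1 - j)) (f / x i)) := by
    rw [Matrix.mul_apply]
    simp only [qBetaMoment, Matrix.of_apply]
    rw [← jacksonIntegral_sum Finset.univ (fun l => qPochCoeff r q d e l j)
      (g := fun l t => t ^ (l : ℕ) * qBetaIntegrand q (a * x i) b
        (a * b * d * e * f * q ^ (r - 1)) d e (f / x i) t) hq fun l _ =>
          ContinuousAt.mul (by fun_prop) (continuousAt_zero_qBetaIntegrand hq ..)]
    have hnode (u : ℂ) (hd : ∀ k : ℕ, u * d * q ^ k ≠ 1) (he : ∀ k : ℕ, u * e * q ^ k ≠ 1)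
        (k : ℕ) : ∑ l : Fin r, (u * q ^ k) ^ (l : ℕ) * qBetaIntegrand q (a * x i) b
          (a * b * d * e * f * q ^ (r - 1)) d e (f / x i) (u * q ^ k) * qPochCoeff r q d e l j =
        qBetaIntegrand q (a * x i) b (a * b * d * e * f * q ^ (r - 1)) (d * q ^ (j : ℕ))
          (e * q ^ (r - 1 - j)) (f / x i) (u * q ^ k) := by
      rw [← qPoch_mul_qBetaIntegrand hq _ _ (qPochInf_node_ne_zero hq hd k)
        (qPochInf_node_ne_zero hq he k), ← sum_qPochCoeff, Finset.sum_mul]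
      exact Finset.sum_congr rfl fun l _ => by ring
    exact jacksonIntegral_congr (hnode _ (hadx i) (haex i)) (hnode _ hbd hbe)
  have hpow : q ^ (r - 1) = q ^ (j : ℕ) * q ^ (r - 1 - j) := by
    rw [← pow_add]
    congr 1
    omega
  have h := qBetaIntegral_eq (a := a * x i) (b := b) (d := d * q ^ (j : ℕ))
    (e := e * q ^ (r - 1 - j)) (f := f / x i) hq hax hb (mul_pow_ne_one (hadx i) _)
    (mul_pow_ne_one (haex i) _) haf' (mul_pow_ne_one hbd _) (mul_pow_ne_one hbe _) (hbf i)
  -- The balancing condition holds for every `i` and `j`: the exponents `j` and `r - 1 - j` add up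
  -- to `r - 1`, and `x i` cancels.
  rw [show a * x i * b * (d * q ^ (j : ℕ)) * (e * q ^ (r - 1 - j)) * (f / x i) =
      a * b * d * e * f * q ^ (r - 1) by rw [hpow]; field_simp] at h
  have hA := qPochInf_ne_zero hq (hadx i)
  have hB := qPochInf_ne_zero hq (haex i)
  rw [show a * x i * d = d * (a * x i) by ring, qPochInf_eq_qPoch_mul _ hq j] at hA
  rw [show a * x i * e = e * (a * x i) by ring, qPochInf_eq_qPoch_mul _ hq (r - 1 - j)] at hB
  rw [hint, h, show a * d * x i = d * (a * x i) by ring, show a * e * x i = e * (a * x i) by ring,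
    qPochInf_eq_qPoch_mul (d * (a * x i)) hq j,
    qPochInf_eq_qPoch_mul (e * (a * x i)) hq (r - 1 - j),
    show a * x i * (d * q ^ (j : ℕ)) = d * (a * x i) * q ^ (j : ℕ) by ring,
    show a * x i * (e * q ^ (r - 1 - j)) = e * (a * x i) * q ^ (r - 1 - j) by ring,
    show a * x i * (f / x i) = a * f by field_simp,
    show b * (f / x i) = b * f / x i by ring,
    show b * (d * q ^ (j : ℕ)) = b * d * q ^ (j : ℕ) by ring,
    show b * (e * q ^ (r - 1 - j)) = b * e * q ^ (r - 1 - j) by ring,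
    show a * x i * b * (e * q ^ (r - 1 - j)) * (f / x i) = a * b * e * f * q ^ (r - 1 - j) by
      field_simp,
    show a * x i * b * (d * q ^ (j : ℕ)) * (f / x i) = a * b * d * f * q ^ (j : ℕ) by field_simp,
    show a * x i * b * (d * q ^ (j : ℕ)) * (e * q ^ (r - 1 - j)) =
      a * b * d * e * q ^ (r - 1) * x i by rw [hpow]; ring]
  generalize qPoch (d * (a * x i)) q j = A at *
  generalize qPoch (e * (a * x i)) q (r - 1 - j) = B at *
  generalize qPochInf (d * (a * x i) * q ^ (j : ℕ)) q = A' at *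
  generalize qPochInf (e * (a * x i) * q ^ (r - 1 - j)) q = B' at *
  have hA1 := left_ne_zero_of_mul hA
  have hB1 := left_ne_zero_of_mul hB
  generalize qPochInf (a * f) q = c1
  generalize qPochInf (b * f / x i) q = c2
  generalize qPochInf (b * d * q ^ (j : ℕ)) q = c3
  generalize qPochInf (b * e * q ^ (r - 1 - j)) q = c4
  generalize qPochInf (a * b * e * f * q ^ (r - 1 - j)) q = c5
  generalize qPochInf (a * b * d * f * q ^ (j : ℕ)) q = c6
  generalize qPochInf (a * b * d * e * q ^ (r - 1) * x i) q = c7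
  generalize qPochInf (a * x i / b) q = c8
  generalize qPochInf (b * q / (a * x i)) q = c9
  generalize qPochInf q q = c10
  simp only [div_eq_mul_inv, mul_inv]
  -- Only the finite products `A` and `B` have to be cancelled; all other inverses match formally.
  linear_combination b * (1 - q) * c5 * c6 * c7 * c8 * c9 * c10 * c1⁻¹ * c2⁻¹ * c3⁻¹ *
    c4⁻¹ * A'⁻¹ * B'⁻¹ * (-(B * B⁻¹) * mul_inv_cancel₀ hA1 - mul_inv_cancel₀ hB1)

lemma det_qBetaMoment_of_generic (hq0 : q ≠ 0) (hq : ‖q‖ < 1) (ha : a ≠ 0) (hb : b ≠ 0)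
    (hd : d ≠ 0) {x : Fin r → ℂ} (hx : ∀ i, x i ≠ 0)
    (hde : ∀ m < r, ∀ n < r, d ≠ e * q ^ m / q ^ n)
    (hadx : ∀ (i : Fin r) (k : ℕ), a * x i * d * q ^ k ≠ 1)
    (haex : ∀ (i : Fin r) (k : ℕ), a * x i * e * q ^ k ≠ 1)
    (haf : ∀ k : ℕ, a * f * q ^ k ≠ 1)
    (hbd : ∀ k : ℕ, b * d * q ^ k ≠ 1)
    (hbe : ∀ k : ℕ, b * e * q ^ k ≠ 1)
    (hbf : ∀ (i : Fin r) (k : ℕ), b * (f / x i) * q ^ k ≠ 1) :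
    (qBetaMoment q a b (a * b * d * e * f * q ^ (r - 1)) d e f x).det =
      qBetaProd q a b d e f x * (Matrix.vandermonde fun i => a * x i).det := by
  refine mul_right_cancel₀ (det_qPochCoeff_ne_zero hq0 hq hd hde) ?_
  let u : Fin r → ℂ := fun i => b * (1 - q) * (qPochInf q q * qPochInf (a * x i / b) q *
    qPochInf (b * q / (a * x i)) q * qPochInf (a * b * d * e * q ^ (r - 1) * x i) q) /
      (qPochInf (a * d * x i) q * qPochInf (a * e * x i) q * qPochInf (a * f) q *
        qPochInf (b * f / x i) q)
  let α : Fin r → ℂ := fun j =>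
    qPochInf (a * b * e * f * q ^ (r - 1 - j)) q / qPochInf (b * d * q ^ (j : ℕ)) q
  let β : Fin r → ℂ := fun j =>
    qPochInf (a * b * d * f * q ^ (j : ℕ)) q / qPochInf (b * e * q ^ (r - 1 - j)) q
  have hM : qBetaMoment q a b (a * b * d * e * f * q ^ (r - 1)) d e f x * qPochCoeff r q d e =
      Matrix.of fun i j => u i * (Matrix.of fun i j => (α j * β j) *
        (Matrix.vandermonde (fun i => a * x i) * qPochCoeff r q d e) i j) i j := by
    ext i j
    rw [vandermonde_mul_qPochCoeff]
    exact qBetaMoment_mul_qPochCoeff hq ha hb hx hadx haex haf hbd hbe hbf i j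
  have hprod : qBetaProd q a b d e f x = (∏ i, u i) * ((∏ j, α j) * ∏ j, β j) := by
    -- Reversing `j` in `β` alone turns `q ^ j` into `q ^ (r - 1 - j)` and back, as in `qBetaProd`.
    rw [← Equiv.prod_comp Fin.revPerm β, ← Finset.prod_mul_distrib, ← Finset.prod_mul_distrib]
    refine Finset.prod_congr rfl fun i _ => ?_
    have hi := i.isLt
    simp only [u, α, β, Fin.revPerm_apply, Fin.val_rev]
    rw [show r - 1 - (r - ((i : ℕ) + 1)) = i by omega, show r - ((i : ℕ) + 1) = r - 1 - i by omega]
    simp only [div_eq_mul_inv, mul_inv]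
    ring
  rw [← Matrix.det_mul, hM, Matrix.det_mul_column, Matrix.det_mul_row, Finset.prod_mul_distrib,
    Matrix.det_mul, hprod]
  ring

end

/-! ### Removing the genericity condition on `d`. -/

lemma qPochInf_ne_zero_iff {z q : ℂ} (hq : ‖q‖ < 1) :
    qPochInf z q ≠ 0 ↔ ∀ k : ℕ, z * q ^ k ≠ 1 := by
  refine ⟨fun h k hk => h ?_, qPochInf_ne_zero hq⟩
  rw [qPochInf_eq_qPoch_mul z hq (k + 1), qPoch, Finset.prod_range_succ, hk]
  simp

/-- Infinitely many conditions amount to the nonvanishing of one continuous function, hence are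
open. -/
lemma eventually_forall_mul_pow_ne_one {q : ℂ} (hq : ‖q‖ < 1) {u d : ℂ}
    (h : ∀ k : ℕ, u * d * q ^ k ≠ 1) : ∀ᶠ z in 𝓝 d, ∀ k : ℕ, u * z * q ^ k ≠ 1 := by
  have hc : ContinuousAt (fun z => qPochInf (u * z) q) d :=
    continuousAt_qPochInf_comp hq (by fun_prop)
  filter_upwards [hc.eventually_ne (qPochInf_ne_zero hq h)] with z hz
  exact (qPochInf_ne_zero_iff hq).1 hz

section

variable {r : ℕ} {q a b d e f : ℂ}

/-- The parameter `c` moves along with `z`, so the balancing condition persists in the limit. -/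
lemma continuousAt_det_qBetaMoment (hq : ‖q‖ < 1) {x : Fin r → ℂ}
    (hadx : ∀ (i : Fin r) (k : ℕ), a * x i * d * q ^ k ≠ 1)
    (haex : ∀ (i : Fin r) (k : ℕ), a * x i * e * q ^ k ≠ 1)
    (hafx : ∀ (i : Fin r) (k : ℕ), a * x i * (f / x i) * q ^ k ≠ 1)
    (hbd : ∀ k : ℕ, b * d * q ^ k ≠ 1)
    (hbe : ∀ k : ℕ, b * e * q ^ k ≠ 1)
    (hbf : ∀ (i : Fin r) (k : ℕ), b * (f / x i) * q ^ k ≠ 1) :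
    ContinuousAt (fun z => (qBetaMoment q a b (a * b * z * e * f * q ^ (r - 1)) z e f x).det) d := by
  refine ContinuousAt.comp (g := fun M : Matrix (Fin r) (Fin r) ℂ => M.det)
    (continuous_id.matrix_det).continuousAt ?_
  refine continuousAt_pi.2 fun i => continuousAt_pi.2 fun l => ?_
  exact continuousAt_jacksonIntegral_qBetaIntegrand hq l (by fun_prop) continuousAt_id
    continuousAt_const continuousAt_const (hadx i) (haex i) (hafx i) hbd hbe (hbf i)

lemma continuousAt_qBetaProd (hq : ‖q‖ < 1) {x : Fin r → ℂ}
    (hadx : ∀ (i : Fin r) (k : ℕ), a * x i * d * q ^ k ≠ 1)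
    (haex : ∀ (i : Fin r) (k : ℕ), a * x i * e * q ^ k ≠ 1)
    (haf : ∀ k : ℕ, a * f * q ^ k ≠ 1)
    (hbd : ∀ k : ℕ, b * d * q ^ k ≠ 1)
    (hbe : ∀ k : ℕ, b * e * q ^ k ≠ 1)
    (hbf : ∀ (i : Fin r) (k : ℕ), b * (f / x i) * q ^ k ≠ 1) :
    ContinuousAt (fun z => qBetaProd q a b z e f x) d := by
  have hq' {g : ℂ → ℂ} (hg : ContinuousAt g d) : ContinuousAt (fun y => qPochInf (g y) q) d :=
    continuousAt_qPochInf_comp hq hg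
  refine tendsto_finsetProd _ fun i _ => ContinuousAt.div ?_ ?_ ?_
  · exact continuousAt_const.mul ((((((hq' (by fun_prop)).mul (hq' (by fun_prop))).mul
      (hq' (by fun_prop))).mul (hq' (by fun_prop))).mul (hq' (by fun_prop))).mul
      (hq' (by fun_prop)))
  · exact (((((hq' (by fun_prop)).mul (hq' (by fun_prop))).mul
      (hq' (by fun_prop))).mul (hq' (by fun_prop))).mul (hq' (by fun_prop))).mul
      (hq' (by fun_prop))
  · have h1 := qPochInf_ne_zero hq (hadx i)
    have h2 := qPochInf_ne_zero hq (haex i)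
    have h3 := qPochInf_ne_zero hq haf
    have h4 := qPochInf_ne_zero hq (z := b * d * q ^ (i : ℕ))
      fun k => by rw [mul_assoc _ (q ^ _), ← pow_add]; exact hbd _
    have h5 := qPochInf_ne_zero hq (z := b * e * q ^ (i : ℕ))
      fun k => by rw [mul_assoc _ (q ^ _), ← pow_add]; exact hbe _
    have h6 := qPochInf_ne_zero hq (hbf i)
    rw [mul_right_comm] at h1 h2
    rw [← mul_div_assoc] at h6
    simp [*]

lemma det_qBetaMoment (hq0 : q ≠ 0) (hq : ‖q‖ < 1) (ha : a ≠ 0) (hb : b ≠ 0)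
    {x : Fin r → ℂ} (hx : ∀ i, x i ≠ 0)
    (hadx : ∀ (i : Fin r) (k : ℕ), a * x i * d * q ^ k ≠ 1)
    (haex : ∀ (i : Fin r) (k : ℕ), a * x i * e * q ^ k ≠ 1)
    (haf : ∀ k : ℕ, a * f * q ^ k ≠ 1)
    (hbd : ∀ k : ℕ, b * d * q ^ k ≠ 1)
    (hbe : ∀ k : ℕ, b * e * q ^ k ≠ 1)
    (hbf : ∀ (i : Fin r) (k : ℕ), b * (f / x i) * q ^ k ≠ 1) :
    (qBetaMoment q a b (a * b * d * e * f * q ^ (r - 1)) d e f x).det =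
      qBetaProd q a b d e f x * (Matrix.vandermonde fun i => a * x i).det := by
  have hafx (i : Fin r) (k : ℕ) : a * x i * (f / x i) * q ^ k ≠ 1 := by
    have hxi := hx i
    rw [show a * x i * (f / x i) = a * f by field_simp]
    exact haf k
  have hL := continuousAt_det_qBetaMoment hq hadx haex hafx hbd hbe hbf
  have hR := (continuousAt_qBetaProd hq hadx haex haf hbd hbe hbf).mul
    (continuousAt_const (y := (Matrix.vandermonde fun i => a * x i).det))
  -- The point `d` may itself be an excluded value, so the two sides are compared on a punctured
  -- neighbourhood.
  refine tendsto_nhds_unique_of_eventuallyEq (hL.mono_left (nhdsWithin_le_nhds (s := {d}ᶜ)))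
    (hR.mono_left nhdsWithin_le_nhds) ?_
  have hne (v : ℂ) : ∀ᶠ z in 𝓝[≠] d, z ≠ v := by
    by_cases hv : v = d
    · rw [hv]
      exact self_mem_nhdsWithin
    · exact nhdsWithin_le_nhds (isOpen_ne.mem_nhds (Ne.symm hv))
  have h1 : ∀ᶠ z in 𝓝[≠] d, ∀ m < r, ∀ n < r, z ≠ e * q ^ m / q ^ n := by
    simp only [← Finset.mem_range, Finset.eventually_all]
    exact fun m _ n _ => hne _
  have h2 : ∀ᶠ z in 𝓝[≠] d, ∀ (i : Fin r) (k : ℕ), a * x i * z * q ^ k ≠ 1 :=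
    nhdsWithin_le_nhds (eventually_all.2 fun i => eventually_forall_mul_pow_ne_one hq (hadx i))
  have h3 : ∀ᶠ z in 𝓝[≠] d, ∀ k : ℕ, b * z * q ^ k ≠ 1 :=
    nhdsWithin_le_nhds (eventually_forall_mul_pow_ne_one hq hbd)
  filter_upwards [h1, h2, h3, hne 0] with z hz1 hz2 hz3 hz4
  exact det_qBetaMoment_of_generic hq0 hq ha hb hz4 hx hz1 hz2 haex haf hz3 hbe hbf

end

/-! ### The multiple integral. -/

theorem theorem6p1 (r : ℕ) (q a b c d e f : ℂ) (x : Fin r → ℂ)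
    (hq0 : 0 < ‖q‖) (hq1 : ‖q‖ < 1)
    (ha : a ≠ 0) (hb : b ≠ 0) (hd : d ≠ 0) (he : e ≠ 0) (hf : f ≠ 0) (hx : ∀ i, x i ≠ 0)
    -- the balancing condition `c = a b d e f q ^ (r - 1)`
    (hc : c = a * b * d * e * f * q ^ ((r : ℤ) - 1))
    -- no denominator of the integrand vanishes at a node `a x_i q ^ k` or `b q ^ k`
    (hadx : ∀ (i : Fin r) (k : ℕ), a * d * x i * q ^ k ≠ 1)
    (haex : ∀ (i : Fin r) (k : ℕ), a * e * x i * q ^ k ≠ 1)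
    (haf : ∀ k : ℕ, a * f * q ^ k ≠ 1)
    (hbd : ∀ k : ℕ, b * d * q ^ k ≠ 1)
    (hbe : ∀ k : ℕ, b * e * q ^ k ≠ 1)
    (hbf : ∀ (i : Fin r) (k : ℕ), b * f / x i * q ^ k ≠ 1) :
    QIntegrable q (fun i => a * x i) (fun _ => b)
        (fun t => vandermondeProd t *
          ∏ i : Fin r,
            (qPochInf (q * t i / (a * x i)) q * qPochInf (q * t i / b) q * qPochInf (c * t i) q) /
            (qPochInf (d * t i) q * qPochInf (e * t i) q * qPochInf (f * t i / x i) q)) ∧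
      qIntegral q (fun i => a * x i) (fun _ => b)
        (fun t => vandermondeProd t *
          ∏ i : Fin r,
            (qPochInf (q * t i / (a * x i)) q * qPochInf (q * t i / b) q * qPochInf (c * t i) q) /
            (qPochInf (d * t i) q * qPochInf (e * t i) q * qPochInf (f * t i / x i) q)) =
      -- in what follows `i : Fin r` counts from `0`, so it stands for the usual index minus one
      a ^ (r.choose 2) * b ^ r * (1 - q) ^ r * vandermondeProd x *
        ∏ i : Fin r,
          (qPochInf q q * qPochInf (a * x i / b) q * qPochInf (b * q / (a * x i)) q *
            qPochInf (c * q ^ (-(i : ℤ)) / d) q * qPochInf (c * q ^ (-(i : ℤ)) / e) q *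
            qPochInf (c * x i / f) q) /
          (qPochInf (a * d * x i) q * qPochInf (a * e * x i) q * qPochInf (a * f) q *
            qPochInf (b * d * q ^ (i : ℕ)) q * qPochInf (b * e * q ^ (i : ℕ)) q *
            qPochInf (b * f / x i) q) := by
  have hqz : q ≠ 0 := norm_pos_iff.1 hq0
  have hadx' (i : Fin r) (k : ℕ) : a * x i * d * q ^ k ≠ 1 := by
    rw [mul_right_comm a]
    exact hadx i k
  have haex' (i : Fin r) (k : ℕ) : a * x i * e * q ^ k ≠ 1 := by
    rw [mul_right_comm a]
    exact haex i k
  have hbf' (i : Fin r) (k : ℕ) : b * (f / x i) * q ^ k ≠ 1 := by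
    rw [← mul_div_assoc]
    exact hbf i k
  -- The same `ε` serves for `t` and for `x`, so its value is never needed.
  obtain ⟨ε, hε⟩ := exists_vandermondeProd_eq r
  -- The sum over `Unit` presents multiplication by `ε` as a case of `qIntegral_sum`.
  have hint : (fun t : Fin r → ℂ => vandermondeProd t *
      ∏ i : Fin r,
        (qPochInf (q * t i / (a * x i)) q * qPochInf (q * t i / b) q * qPochInf (c * t i) q) /
        (qPochInf (d * t i) q * qPochInf (e * t i) q * qPochInf (f * t i / x i) q)) =
      fun t => ∑ _n ∈ Finset.univ (α := Unit), ε * (Matrix.of fun i j : Fin r =>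
        t i ^ (j : ℕ) * qBetaIntegrand q (a * x i) b c d e (f / x i) (t i)).det := by
    funext t
    have h : (Matrix.of fun i j : Fin r =>
        t i ^ (j : ℕ) * qBetaIntegrand q (a * x i) b c d e (f / x i) (t i)) =
        Matrix.of fun i j : Fin r =>
          qBetaIntegrand q (a * x i) b c d e (f / x i) (t i) * Matrix.vandermonde t i j := by
      ext i j
      exact mul_comm _ _
    rw [h, Matrix.det_mul_column, hε]
    simp only [qBetaIntegrand, div_mul_eq_mul_div, Finset.univ_unique, Finset.sum_singleton]
    ring
  have hdet := qIntegral_det (lo := fun i => a * x i) (hi := fun _ => b)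
    (g := fun i j : Fin r => fun t =>
      t ^ (j : ℕ) * qBetaIntegrand q (a * x i) b c d e (f / x i) t) hq1
    fun i j => ContinuousAt.mul (by fun_prop) (continuousAt_zero_qBetaIntegrand hq1 ..)
  have hsum := qIntegral_sum (Finset.univ (α := Unit)) (fun _ => ε) fun _ _ => hdet.1
  rw [← hint] at hsum
  refine ⟨hsum.1, ?_⟩
  rw [hsum.2, Finset.univ_unique, Finset.sum_singleton, hdet.2]
  -- An index `i` forces `r ≥ 1`, where the natural and integer exponents agree. For `r = 0` they
  -- differ, but the matrices and products are empty.
  have hcr (i : Fin r) : c = a * b * d * e * f * q ^ (r - 1) := by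
    have hi := i.isLt
    rw [hc, ← zpow_natCast, Nat.cast_sub (by omega), Nat.cast_one]
  have hmom : (Matrix.of fun i j : Fin r => jacksonIntegral q (a * x i) b fun t =>
      t ^ (j : ℕ) * qBetaIntegrand q (a * x i) b c d e (f / x i) t) =
      qBetaMoment q a b (a * b * d * e * f * q ^ (r - 1)) d e f x := by
    ext i j
    rw [qBetaMoment, ← hcr i]
  rw [hmom, det_qBetaMoment hqz hq1 ha hb hx hadx' haex' haf hbd hbe hbf',
    det_vandermonde_mul, hε]
  have hconst : b ^ r * (1 - q) ^ r = ∏ _i : Fin r, b * (1 - q) := by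
    rw [Finset.prod_const, Finset.card_univ, Fintype.card_fin, mul_pow]
  rw [mul_assoc (a ^ _), hconst]
  have hprod : (∏ _i : Fin r, b * (1 - q)) * ∏ i : Fin r,
          (qPochInf q q * qPochInf (a * x i / b) q * qPochInf (b * q / (a * x i)) q *
            qPochInf (c * q ^ (-(i : ℤ)) / d) q * qPochInf (c * q ^ (-(i : ℤ)) / e) q *
            qPochInf (c * x i / f) q) /
          (qPochInf (a * d * x i) q * qPochInf (a * e * x i) q * qPochInf (a * f) q *
            qPochInf (b * d * q ^ (i : ℕ)) q * qPochInf (b * e * q ^ (i : ℕ)) q *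
            qPochInf (b * f / x i) q) = qBetaProd q a b d e f x := by
    rw [← Finset.prod_mul_distrib, qBetaProd]
    refine Finset.prod_congr rfl fun i _ => ?_
    have hpow : q ^ (r - 1) * q ^ (-(i : ℤ)) = q ^ (r - 1 - (i : ℕ)) := by
      have hi := i.isLt
      rw [← zpow_natCast, ← zpow_natCast, ← zpow_add₀ hqz]
      congr 1
      omega
    rw [show c * q ^ (-(i : ℤ)) / d = a * b * e * f * q ^ (r - 1 - (i : ℕ)) by
        rw [← hpow, hcr i]; field_simp,
      show c * q ^ (-(i : ℤ)) / e = a * b * d * f * q ^ (r - 1 - (i : ℕ)) by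
        rw [← hpow, hcr i]; field_simp,
      show c * x i / f = a * b * d * e * q ^ (r - 1) * x i by rw [hcr i]; field_simp,
      ← mul_div_assoc]
  rw [← hprod]
  ring
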